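/- **Theorem (Aggregation).** Consider a discounted Markov decision process with finite state space $S$, finite nonempty action sets $\mathcal A(i)$ ($i\in S$), transition probabilities $P_{ij}(u)$, costs $c(i,u)\ge 0$ and discount factor $\alpha\in(0,1)$. A policy $\mu$ chooses an action $\mu(i)\in\mathcal A(i)$ for every $i \in S$. It induces a Markov chain $(X^\mu_m)_{m\ge0}$ on $S$ with transition probabilities $P_{ij}(\mu(i))$; let $J^\mu(i)=\mathbb E\big[\sum_{m\ge0}\alpha^m c(X^\mu_m,\mu(X^\mu_m))\,\big|\,X_0^\mu=i\big]$, $J^*=\min_\mu J^\mu$ and $(T_\mu J)(i)=c(i,\mu(i))+\alpha\sum_jP_{ij}(\mu(i))J(j)$. Let $G$ be the directed graph on $S$ with an edge $(i,j)$ whenever $P_{ij}(u)>0$ for some $u\in\mathcal A(i)$. A state $i$ is recurrent if $i$ can be reached in $G$ from every state that can be reached from $i$, and transient otherwise; it is absorbing if $P_{ii}(u)=1$ for all $u\in\mathcal A(i)$. Let $p$ be a probability distribution on $S$, and let $S$ be partitioned into clusters $\mathcal C_1,\dots,\mathcal C_k$. Assume: 1. for all $i,j\in S$ and $u,v\in\mathcal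 A(i)$: $P_{ij}(u)>0$ if and only if $P_{ij}(v)>0$; 2. the subgraph of $G$ induced by the transient states has no directed cycle (in particular no self-loop), and every state that is not transient is absorbing; 3. $J^*(i)=J^*(j)$ whenever $i,j$ lie in the same cluster; 4. all states in the same cluster have the same maximum distance to an absorbing state, that is, the same maximal length of a directed path (without repeated vertices) in $G$ to an absorbing state; 5. for every policy $\mu$ and every cluster $\mathcal C_c$, the chain $X^\mu$ with initial distribution $p$ visits $\mathcal C_c$ with positive probability. Let $\beta:\mathbb N\to[0,\infty)$ satisfy $\sum_t\beta(t)=\infty$ and $\sum_t\beta(t)^2<\infty$. Starting from a deterministic $\theta_0\in\mathbb R^k$, the algorithm does the following in each iteration $t=0,1,2,\dots$: it sets $J_t(i)=\theta_t(c)$ for $i\in\mathcal C_c$; it takes a greedy policy $\mu_t\in\arg\min_\mu T_\mu J_t$, where ties may be broken in any way that depends only on the information available before the trajectory of iteration $t$ is simulated; it simulates a trajectory $X^{\mu_t}$ which, conditionally on that information, is a Markov chain induced by $\mu_t$ with initial distribution $p$; and for every cluster $\mathcal C_c$ visited by the trajectory, first at time $N_t(c)$, it sets $$\theta_{t+1}(c)=(1-\gamma_t(c))\,\theta_t(c)+\gamma_t(c)\sum_{m\ge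 N_t(c)}\alpha^{m-N_t(c)}c\big(X^{\mu_t}_m,\mu_t(X^{\mu_t}_m)\big),$$ while $\theta_{t+1}(c)=\theta_t(c)$ for the clusters that are not visited. The step sizes are either $\gamma_t(c)=\beta(t)$ for all $t,c$, or $\gamma_t(c)=\beta(n_t(c))$ for all $t,c$, where $n_t(c)$ is the number of iterations $\tau<t$ whose trajectory visited $\mathcal C_c$. Then, almost surely, $J_t(i)\to J^*(i)$ as $t\to\infty$ for every $i\in S$; equivalently, almost surely $\theta_t(c)$ converges to the common value of $J^*$ on $\mathcal C_c$ for every $c$. -/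

import Mathlib

open MeasureTheory ProbabilityTheory Filter Topology

noncomputable section

/-- A discounted Markov decision process on the finite state space `S`, with action space `A i`
at state `i`, transition probabilities `P i u j`, nonnegative costs and discount factor in
`(0, 1)`. -/
structure DiscountedMDP (S : Type*) (A : S → Type*) where
  P : (i : S) → A i → PMF S
  cost : (i : S) → A i → ℝ
  cost_nonneg : ∀ i u, 0 ≤ cost i u
  discount : ℝ
  discount_pos : 0 < discount
  discount_lt_one : discount < 1

namespace DiscountedMDP

variable {S : Type*} {A : S → Type*} (M : DiscountedMDP S A)

/-! ### The reachability graph -/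

/-- The edges of the reachability graph. -/
def Edge (i j : S) : Prop := ∃ u : A i, 0 < M.P i u j

/-- The successors of a state do not depend on the action. -/
def CommonTransitions : Prop :=
  ∀ (i j : S) (u v : A i), 0 < M.P i u j ↔ 0 < M.P i v j

/-- `j` can be reached from `i` in zero or more steps of the reachability graph. -/
def Reaches (i j : S) : Prop := Relation.ReflTransGen M.Edge i j

/-- `i` lies in a closed irreducible class: every state reachable from `i` leads back to `i`. -/
def IsRecurrent (i : S) : Prop := ∀ j, M.Reaches i j → M.Reaches j i

def IsTransient (i : S) : Prop := ¬ M.IsRecurrent i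

def IsAbsorbing (i : S) : Prop := ∀ u : A i, M.P i u i = 1

/-- The subgraph induced by the transient states has no directed cycle (self-loops included). -/
def TransientAcyclic : Prop :=
  ∀ i, ¬ Relation.TransGen (fun a b => M.IsTransient a ∧ M.IsTransient b ∧ M.Edge a b) i i

/-- There is a directed path (no repeated vertex) of length `l` from `i` to an absorbing state. -/
def PathToAbsorbing (i : S) (l : ℕ) : Prop :=
  ∃ x : Fin (l + 1) → S, Function.Injective x ∧ x 0 = i ∧ M.IsAbsorbing (x (Fin.last l)) ∧
    ∀ m : Fin l, M.Edge (x m.castSucc) (x m.succ)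

/-- The maximum distance from `i` to an absorbing state: the greatest length of a path from `i`
to an absorbing state (lengths are bounded since paths do not repeat vertices). -/
def maxDist (i : S) : ℕ := sSup {l | M.PathToAbsorbing i l}

/-! ### Trajectories and value functions -/

/-- The Bellman operator `T_π`. -/
def bellman [Fintype S] (π : ∀ i, A i) (J : S → ℝ) (i : S) : ℝ :=
  M.cost i (π i) + M.discount * ∑ j, (M.P i (π i) j).toReal * J j

section Trajectories

variable [Fintype S] [MeasurableSpace S] [MeasurableSingletonClass S]

/-- The one-step transition kernel of the Markov chain induced by the policy `π`. -/
def stepKernel (π : ∀ i, A i) : Kernel S S :=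
  Kernel.ofFunOfCountable fun i => (M.P i (π i)).toMeasure

instance (π : ∀ i, A i) : IsMarkovKernel (M.stepKernel π) :=
  ⟨fun i => by
    change IsProbabilityMeasure (M.P i (π i)).toMeasure
    infer_instance⟩

/-- The law of the next state given the states up to time `n`. -/
def historyKernel (π : ∀ i, A i) (n : ℕ) : Kernel (Finset.Iic n → S) S :=
  (M.stepKernel π).comap (fun h => h ⟨n, Finset.mem_Iic.2 le_rfl⟩) (measurable_pi_apply _)

instance (π : ∀ i, A i) (n : ℕ) : IsMarkovKernel (M.historyKernel π n) := by
  unfold historyKernel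
  infer_instance

/-- The law of the trajectory of the Markov chain induced by `π` and started at `i`. -/
def trajLaw (π : ∀ i, A i) (i : S) : Measure (ℕ → S) :=
  Kernel.traj (X := fun _ => S) (M.historyKernel π) 0 fun _ => i

/-- The law of the trajectory of the Markov chain induced by `π` with initial distribution
`p`. -/
def chainLaw (p : PMF S) (π : ∀ i, A i) : Measure (ℕ → S) :=
  ∑ i, p i • M.trajLaw π i

end Trajectories

/-- The discounted cost of the trajectory `x` from time `N` on, discounted to time `N`. -/
def costFrom (π : ∀ i, A i) (N : ℕ) (x : ℕ → S) : ℝ :=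
  ∑' m : ℕ, M.discount ^ m * M.cost (x (N + m)) (π (x (N + m)))

section Values

variable [Fintype S] [MeasurableSpace S] [MeasurableSingletonClass S]

/-- The value function `J^π`. -/
def value (π : ∀ i, A i) (i : S) : ℝ := ∫ x, M.costFrom π 0 x ∂(M.trajLaw π i)

/-- The optimal value function `J^*`, the minimum of `J^π` over the finitely many policies. -/
def optValue (i : S) : ℝ := ⨅ π : ∀ i, A i, M.value π i

end Values

/-! ### Clusters and the aggregated algorithm -/

/-- The trajectory `x` visits the cluster `c`; `cl i` is the cluster that contains `i`. -/
def Visits {k : ℕ} (cl : S → Fin k) (x : ℕ → S) (c : Fin k) : Prop := ∃ m, cl (x m) = c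

/-- The first time at which `x` visits the cluster `c` (used only if `x` visits `c`). -/
def firstVisit {k : ℕ} (cl : S → Fin k) (x : ℕ → S) (c : Fin k) : ℕ := sInf {m | cl (x m) = c}

/-- The tail cost of the trajectory from its first visit to the cluster `c`. -/
def tailCost {k : ℕ} (cl : S → Fin k) (π : ∀ i, A i) (x : ℕ → S) (c : Fin k) : ℝ :=
  M.costFrom π (firstVisit cl x c) x

/-- The number of iterations before iteration `t` whose trajectory visits the cluster `c`, for
the sequence `x` of trajectories. -/
def visitCount {k : ℕ} (cl : S → Fin k) (x : ℕ → ℕ → S) (t : ℕ) (c : Fin k) : ℕ :=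
  {τ | τ < t ∧ Visits cl (x τ) c}.ncard

/-- A run of optimistic policy iteration with state aggregation on the probability space
`(Ω, Pr)`: `ℱ t` is the information available before the trajectory of iteration `t` is simulated,
`μ t` the policy used and `X t` the trajectory simulated in iteration `t`, `γ t c` the step sizes,
`θ t` the vector of cluster parameters, and `θ₀` its deterministic initial value. Ties in the
choice of the greedy policy may be broken in any way that depends on `ℱ t` only. -/
structure IsAggregatedOPI [Fintype S] [MeasurableSpace S] [MeasurableSingletonClass S]
    {k : ℕ} (cl : S → Fin k) (p : PMF S) (θ₀ : Fin k → ℝ)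
    {Ω : Type*} {mΩ : MeasurableSpace Ω} (Pr : Measure Ω) (ℱ : Filtration ℕ mΩ)
    (γ : ℕ → Ω → Fin k → ℝ) (μ : ℕ → Ω → ∀ i, A i) (X : ℕ → Ω → ℕ → S)
    (θ : ℕ → Ω → Fin k → ℝ) : Prop where
  init : ∀ ω, θ 0 ω = θ₀
  /-- `μ t` minimizes `T_π J_t` over all policies `π`, where `J_t i = θ_t (cl i)`. -/
  greedy : ∀ t ω (π : ∀ i, A i),
    M.bellman (μ t ω) (fun i => θ t ω (cl i)) ≤ M.bellman π (fun i => θ t ω (cl i))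
  policy_measurable : ∀ t (π : ∀ i, A i), MeasurableSet[ℱ t] {ω | μ t ω = π}
  traj_measurable : ∀ t, Measurable[ℱ (t + 1)] (X t)
  /-- Given the past, the trajectory is that of the Markov chain induced by `μ t`, with initial
  state drawn from `p`. -/
  traj_law : ∀ t (B : Set (ℕ → S)), MeasurableSet B →
    Pr⟦X t ⁻¹' B | ℱ t⟧ =ᵐ[Pr] fun ω => (M.chainLaw p (μ t ω)).real B
  update_visited : ∀ t ω c, Visits cl (X t ω) c →
    θ (t + 1) ω c = (1 - γ t ω c) * θ t ω c + γ t ω c * M.tailCost cl (μ t ω) (X t ω) c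
  update_not_visited : ∀ t ω c, ¬ Visits cl (X t ω) c → θ (t + 1) ω c = θ t ω c

end DiscountedMDP

end

/-! ### Deterministic recursions -/

/-! The theorem is pathwise apart from two almost sure facts about each cluster: the step sizes at
the iterations that visit it have infinite sum (`ae_tendsto_sum_stepSize`), and the weighted noise
in its updates forms a convergent series (`ae_exists_tendsto_sum_visitNoise`). Both are instances of
`ae_exists_tendsto_sum`, the convergence of martingale difference series with bounded quadratic
variation.

On a path where both hold, convergence spreads upwards from the absorbing states by induction on
`maxDist`. At an absorbing state greediness minimizes the immediate cost, whatever `J_t` is. Edges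
out of a transient state lead to strictly smaller levels, so once `J_t` converges to `J^*` below
level `d`, the greedy policy, one of finitely many, is eventually optimal at every state of level at
most `d` (`eventually_bellmanFixedPoint_eq_optValue`). From then on a cluster of level `d` receives
unbiased samples of one constant: all its states share the level and the value `J^*`, so it does not
matter which of them is visited first. Averaging with these step sizes then converges to the
constant (`tendsto_zero_of_averaging`).

The noise is centred because the tail cost minus `J^π` at the first visit is a discounted series of
one-step Bellman errors, each with conditional mean zero given the past. -/

theorem eventually_le_of_contraction {u a : ℕ → ℝ} (ha : ∀ᶠ t in atTop, 0 ≤ a t ∧ a t ≤ 1)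
    (hsum : Tendsto (fun n => ∑ t ∈ Finset.range n, a t) atTop atTop)
    (hu : ∀ᶠ t in atTop, u (t + 1) ≤ (1 - a t) * u t) {ε : ℝ} (hε : 0 < ε) :
    ∀ᶠ t in atTop, u t ≤ ε := by
  obtain ⟨T, hT⟩ := (ha.and hu).exists_forall_of_atTop
  -- Since `1 - a ≤ exp (-a)`, the product of the factors is at most the exponential of minus the
  -- sum of the weights. The maximum with zero keeps the bound nonnegative when `u T` is negative.
  have key : ∀ t, T ≤ t → u t ≤ max (u T) 0 *
      Real.exp (∑ j ∈ Finset.range T, a j - ∑ j ∈ Finset.range t, a j) := by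
    intro t ht
    induction t, ht using Nat.le_induction with
    | base => simp
    | succ t ht ih =>
      obtain ⟨⟨h0, h1⟩, h2⟩ := hT t ht
      have h3 : 1 - a t ≤ Real.exp (-a t) := by
        have := Real.add_one_le_exp (-a t)
        linarith
      calc u (t + 1) ≤ (1 - a t) * u t := h2
        _ ≤ (1 - a t) * (max (u T) 0 *
            Real.exp (∑ j ∈ Finset.range T, a j - ∑ j ∈ Finset.range t, a j)) :=
          mul_le_mul_of_nonneg_left ih (by linarith)
        _ ≤ Real.exp (-a t) * (max (u T) 0 *
            Real.exp (∑ j ∈ Finset.range T, a j - ∑ j ∈ Finset.range t, a j)) :=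
          mul_le_mul_of_nonneg_right h3 (by positivity)
        _ = _ := by
          rw [Finset.sum_range_succ, mul_left_comm, ← Real.exp_add]
          ring_nf
  have hlim : Tendsto (fun t => max (u T) 0 *
      Real.exp (∑ j ∈ Finset.range T, a j - ∑ j ∈ Finset.range t, a j)) atTop (𝓝 0) := by
    have h : Tendsto (fun t => ∑ j ∈ Finset.range T, a j - ∑ j ∈ Finset.range t, a j)
        atTop atBot := by
      simpa only [sub_eq_add_neg, Function.comp_apply] using
        tendsto_atBot_add_const_left _ _ (tendsto_neg_atTop_atBot.comp hsum)
    simpa using (Real.tendsto_exp_atBot.comp h).const_mul (max (u T) 0)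
  filter_upwards [hlim.eventually_le_const hε, eventually_ge_atTop T] with t h1 h2
  exact (key t h2).trans h1

/-- The averaging recursion `x (t + 1) = (1 - a t) * x t + noise` with vanishing, non-summable
weights tends to zero if the series of the noise converges. -/
theorem tendsto_zero_of_averaging {x a s : ℕ → ℝ} {l : ℝ} (ha0 : ∀ t, 0 ≤ a t)
    (ha : Tendsto a atTop (𝓝 0))
    (hsum : Tendsto (fun n => ∑ t ∈ Finset.range n, a t) atTop atTop)
    (hs : Tendsto s atTop (𝓝 l))
    (hx : ∀ᶠ t in atTop, x (t + 1) = (1 - a t) * x t + (s (t + 1) - s t)) :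
    Tendsto x atTop (𝓝 0) := by
  have ha' : ∀ᶠ t in atTop, 0 ≤ a t ∧ a t ≤ 1 := by
    filter_upwards [ha.eventually_le_const one_pos] with t ht using ⟨ha0 t, ht⟩
  have hr : Tendsto (fun t => s t - l) atTop (𝓝 0) := by
    simpa using hs.sub_const l
  -- Subtracting the remainder `s t - l` replaces the noise by `-a t * (s t - l)`, a weighted
  -- average with a small target. Once `|s t - l| ≤ ε / 2`, the excess of the absolute value over `ε
  -- / 2` contracts.
  have hy : Tendsto (fun t => x t - (s t - l)) atTop (𝓝 0) := by
    rw [Metric.tendsto_atTop']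
    suffices h : ∀ ε > 0, ∀ᶠ t in atTop, |x t - (s t - l)| ≤ ε by
      intro ε hε
      obtain ⟨N, hN⟩ := (h (ε / 2) (half_pos hε)).exists_forall_of_atTop
      refine ⟨N, fun n hn => ?_⟩
      rw [Real.dist_0_eq_abs]
      linarith [hN n hn.le]
    intro ε hε
    have hrε : ∀ᶠ t in atTop, |s t - l| ≤ ε / 2 := by
      have := hr.abs
      rw [abs_zero] at this
      exact this.eventually_le_const (half_pos hε)
    have := eventually_le_of_contraction (u := fun t => |x t - (s t - l)| - ε / 2) ha' hsum
      (by
        filter_upwards [ha', hx, hrε] with t h1 h2 h3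
        have e : x (t + 1) - (s (t + 1) - l)
            = (1 - a t) * (x t - (s t - l)) + a t * (-(s t - l)) := by
          rw [h2]; ring
        have h4 : |x (t + 1) - (s (t + 1) - l)|
            ≤ (1 - a t) * |x t - (s t - l)| + a t * |s t - l| := by
          rw [e]
          refine (abs_add_le _ _).trans ?_
          rw [abs_mul, abs_mul, abs_neg, abs_of_nonneg h1.1, abs_of_nonneg (sub_nonneg.2 h1.2)]
        have h5 := mul_le_mul_of_nonneg_left h3 h1.1
        linarith) (half_pos hε)
    filter_upwards [this] with t ht
    linarith
  simpa using hy.add hr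

/-! ### Martingale difference series -/

/-- A series of martingale differences with bounded quadratic variation converges almost
everywhere. -/
theorem ae_exists_tendsto_sum_of_condExp_eq_zero {Ω : Type*} {mΩ : MeasurableSpace Ω}
    {Pr : Measure Ω} [IsProbabilityMeasure Pr] {ℱ : Filtration ℕ mΩ} {ξ : ℕ → Ω → ℝ}
    (hm : ∀ t, Measurable[ℱ (t + 1)] (ξ t)) (hce : ∀ t, Pr[ξ t | ℱ t] =ᵐ[Pr] 0) {K : ℝ}
    (hK : ∀ n ω, ∑ t ∈ Finset.range n, ξ t ω ^ 2 ≤ K) :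
    ∀ᵐ ω ∂Pr, ∃ l, Tendsto (fun n => ∑ t ∈ Finset.range n, ξ t ω) atTop (𝓝 l) := by
  have hb : ∀ t ω, |ξ t ω| ≤ K + 1 := fun t ω => by
    have h1 : ξ t ω ^ 2 ≤ K := (Finset.single_le_sum (f := fun t => ξ t ω ^ 2)
      (fun i _ => sq_nonneg _) (Finset.self_mem_range_succ t)).trans (hK (t + 1) ω)
    rw [abs_le]
    constructor <;> nlinarith [sq_nonneg (ξ t ω - 1), sq_nonneg (ξ t ω + 1)]
  set Y : ℕ → Ω → ℝ := fun n ω => ∑ t ∈ Finset.range n, ξ t ω with hY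
  have hYm : ∀ n, Measurable[ℱ n] (Y n) := fun n =>
    Finset.measurable_sum (m := ℱ n) _ fun t ht =>
      (hm t).mono (ℱ.mono (Nat.succ_le_of_lt (Finset.mem_range.1 ht))) le_rfl
  have hYb : ∀ n ω, |Y n ω| ≤ n * (K + 1) := fun n ω =>
    (Finset.abs_sum_le_sum_abs _ _).trans
      ((Finset.sum_le_sum fun t _ => hb t ω).trans_eq (by
        rw [Finset.sum_const, Finset.card_range, nsmul_eq_mul]))
  have hYm' : ∀ n, AEStronglyMeasurable (Y n) Pr := fun n =>
    ((hYm n).mono (ℱ.le n) le_rfl).aestronglyMeasurable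
  have hξm' : ∀ n, AEStronglyMeasurable (ξ n) Pr := fun n =>
    ((hm n).mono (ℱ.le _) le_rfl).aestronglyMeasurable
  have hξi : ∀ n, Integrable (ξ n) Pr := fun n =>
    Integrable.of_bound (hξm' n) (K + 1) (ae_of_all _ (hb n))
  have hYi : ∀ n, Integrable (Y n) Pr := fun n =>
    Integrable.of_bound (hYm' n) (n * (K + 1)) (ae_of_all _ (hYb n))
  have hYξi : ∀ n, Integrable (Y n * ξ n) Pr := fun n =>
    (hξi n).bdd_mul (hYm' n) (ae_of_all _ (hYb n))
  have hξ2i : ∀ n, Integrable (fun ω => ξ n ω ^ 2) Pr := fun n => by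
    simp_rw [sq]
    exact (hξi n).bdd_mul (hξm' n) (ae_of_all _ (hb n))
  have hY2i : ∀ n, Integrable (fun ω => Y n ω ^ 2) Pr := fun n => by
    simp_rw [sq]
    exact (hYi n).bdd_mul (hYm' n) (ae_of_all _ (hYb n))
  have hmart : Martingale Y ℱ Pr := by
    refine martingale_of_condExp_sub_eq_zero_nat (fun n => (hYm n).stronglyMeasurable) hYi
      fun n => ?_
    have : Y (n + 1) - Y n = ξ n := by
      ext ω
      simp [hY, Finset.sum_range_succ]
    rw [this]
    exact hce n
  -- Orthogonality of increments: `Y n` is known at time `n` and comes out of the conditional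
  -- expectation of `ξ n`.
  have hcross : ∀ n, ∫ ω, Y n ω * ξ n ω ∂Pr = 0 := fun n => by
    have h := condExp_mul_of_stronglyMeasurable_left (hYm n).stronglyMeasurable (hYξi n) (hξi n)
    have h2 : Pr[Y n * ξ n | ℱ n] =ᵐ[Pr] 0 := by
      filter_upwards [h, hce n] with ω h1 h2
      simp [h1, h2]
    have h3 := integral_condExp (ℱ.le n) (μ := Pr) (f := Y n * ξ n)
    rw [integral_congr_ae h2] at h3
    simpa using h3.symm
  have hsq : ∀ n, ∫ ω, Y n ω ^ 2 ∂Pr = ∫ ω, ∑ t ∈ Finset.range n, ξ t ω ^ 2 ∂Pr := by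
    intro n
    induction n with
    | zero => simp [hY]
    | succ n ih =>
      have e : ∀ ω, Y (n + 1) ω ^ 2 = Y n ω ^ 2 + 2 * (Y n ω * ξ n ω) + ξ n ω ^ 2 := fun ω => by
        simp only [hY, Finset.sum_range_succ]
        ring
      simp_rw [e, Finset.sum_range_succ]
      have hi2 : Integrable (fun ω => 2 * (Y n ω * ξ n ω)) Pr := (hYξi n).const_mul 2
      rw [integral_add (f := fun ω => Y n ω ^ 2 + 2 * (Y n ω * ξ n ω))
          ((hY2i n).add hi2) (hξ2i n), integral_add (hY2i n) hi2,
        integral_add (integrable_finsetSum _ fun t _ => hξ2i t) (hξ2i n), ih,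
        integral_const_mul, hcross]
      simp
  have hL1 : ∀ n, ∫ ω, ‖Y n ω‖ ∂Pr ≤ 1 + K := fun n => by
    have h1 : ∫ ω, ‖Y n ω‖ ∂Pr ≤ ∫ ω, (1 + Y n ω ^ 2) ∂Pr :=
      integral_mono (hYi n).norm ((integrable_const _).add (hY2i n)) fun ω => by
        rw [Real.norm_eq_abs]
        nlinarith [sq_nonneg (|Y n ω| - 1), sq_abs (Y n ω), abs_nonneg (Y n ω)]
    have h2 : ∫ ω, ∑ t ∈ Finset.range n, ξ t ω ^ 2 ∂Pr ≤ K := by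
      refine (integral_mono (integrable_finsetSum _ fun t _ => hξ2i t) (integrable_const K)
        (hK n)).trans_eq (by simp)
    rw [integral_add (integrable_const _) (hY2i n), hsq n] at h1
    simp only [integral_const, probReal_univ, smul_eq_mul, one_mul] at h1
    linarith
  refine hmart.submartingale.exists_ae_tendsto_of_bdd (R := (1 + K).toNNReal) fun n => ?_
  rw [eLpNorm_one_eq_lintegral_enorm, ← ofReal_integral_norm_eq_lintegral_enorm (hYi n)]
  exact ENNReal.ofReal_le_ofReal (hL1 n)

namespace DiscountedMDP

variable {S : Type*} {A : S → Type*} (M : DiscountedMDP S A)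

/-! ### Bellman operators and optimal policies -/

section BellmanOperators

variable [Fintype S]

theorem sum_toReal_P (i : S) (u : A i) : ∑ j, (M.P i u j).toReal = 1 := by
  have h := (M.P i u).tsum_coe
  rw [tsum_fintype] at h
  rw [← ENNReal.toReal_sum fun j _ => (M.P i u).apply_ne_top j, h, ENNReal.toReal_one]

theorem bellman_sub_bellman (π : ∀ i, A i) (J J' : S → ℝ) (i : S) :
    M.bellman π J i - M.bellman π J' i =
      M.discount * ∑ j, (M.P i (π i) j).toReal * (J j - J' j) := by
  simp only [bellman, mul_sub, Finset.sum_sub_distrib]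
  ring

theorem contractingWith_bellman (π : ∀ i, A i) :
    ContractingWith ⟨M.discount, M.discount_pos.le⟩ (M.bellman π) := by
  refine ⟨M.discount_lt_one, LipschitzWith.of_dist_le_mul fun J J' => ?_⟩
  change _ ≤ M.discount * dist J J'
  refine (dist_pi_le_iff (mul_nonneg M.discount_pos.le dist_nonneg)).2 fun i => ?_
  rw [Real.dist_eq, bellman_sub_bellman, abs_mul, abs_of_pos M.discount_pos]
  refine mul_le_mul_of_nonneg_left ?_ M.discount_pos.le
  calc |∑ j, (M.P i (π i) j).toReal * (J j - J' j)|
      ≤ ∑ j, |(M.P i (π i) j).toReal * (J j - J' j)| := Finset.abs_sum_le_sum_abs _ _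
    _ ≤ ∑ j, (M.P i (π i) j).toReal * dist J J' := by
        refine Finset.sum_le_sum fun j _ => ?_
        rw [abs_mul, abs_of_nonneg ENNReal.toReal_nonneg, ← Real.dist_eq]
        exact mul_le_mul_of_nonneg_left (dist_le_pi_dist J J' j) ENNReal.toReal_nonneg
    _ = dist J J' := by rw [← Finset.sum_mul, sum_toReal_P, one_mul]

/-- The fixed point of the Bellman operator of the policy `π`. -/
noncomputable def bellmanFixedPoint (π : ∀ i, A i) : S → ℝ :=
  ContractingWith.fixedPoint (M.bellman π) (M.contractingWith_bellman π)

theorem bellman_bellmanFixedPoint (π : ∀ i, A i) :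
    M.bellman π (M.bellmanFixedPoint π) = M.bellmanFixedPoint π :=
  (M.contractingWith_bellman π).fixedPoint_isFixedPt

/-- Maximum principle: at a maximizer of `D` the average is at most the maximum, so the maximum is
at most `discount < 1` times itself. It yields both comparison lemmas below. -/
theorem nonpos_of_le_discount_mul (π : ∀ i, A i) {D : S → ℝ}
    (hD : ∀ i, D i ≤ M.discount * ∑ j, (M.P i (π i) j).toReal * D j) (i : S) : D i ≤ 0 := by
  have : Nonempty S := ⟨i⟩
  obtain ⟨m, hm⟩ := Finite.exists_max D
  refine (hm i).trans ?_
  have h1 : ∑ j, (M.P m (π m) j).toReal * D j ≤ D m := by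
    calc ∑ j, (M.P m (π m) j).toReal * D j ≤ ∑ j, (M.P m (π m) j).toReal * D m :=
          Finset.sum_le_sum fun j _ => mul_le_mul_of_nonneg_left (hm j) ENNReal.toReal_nonneg
      _ = D m := by rw [← Finset.sum_mul, sum_toReal_P, one_mul]
  have h2 := (hD m).trans (mul_le_mul_of_nonneg_left h1 M.discount_pos.le)
  nlinarith [M.discount_lt_one]

theorem le_bellmanFixedPoint (π : ∀ i, A i) {U : S → ℝ} (hU : U ≤ M.bellman π U) :
    U ≤ M.bellmanFixedPoint π := by
  intro i
  refine sub_nonpos.1 (M.nonpos_of_le_discount_mul π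
    (D := fun i => U i - M.bellmanFixedPoint π i) (fun i => ?_) i)
  rw [← bellman_sub_bellman, bellman_bellmanFixedPoint]
  linarith [hU i]

theorem bellmanFixedPoint_le (π : ∀ i, A i) {U : S → ℝ} (hU : M.bellman π U ≤ U) :
    M.bellmanFixedPoint π ≤ U := by
  intro i
  refine sub_nonpos.1 (M.nonpos_of_le_discount_mul π
    (D := fun i => M.bellmanFixedPoint π i - U i) (fun i => ?_) i)
  rw [← bellman_sub_bellman, bellman_bellmanFixedPoint]
  linarith [hU i]

theorem exists_bellman_le [∀ i, Finite (A i)] [∀ i, Nonempty (A i)] (J : S → ℝ) :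
    ∃ π : ∀ i, A i, ∀ π', M.bellman π J ≤ M.bellman π' J := by
  choose π hπ using fun i => Finite.exists_min
    fun u : A i => M.cost i u + M.discount * ∑ j, (M.P i u j).toReal * J j
  exact ⟨π, fun π' i => hπ i (π' i)⟩

/-- There is a policy whose value satisfies the Bellman optimality equation. -/
theorem exists_optimal_policy [∀ i, Finite (A i)] [∀ i, Nonempty (A i)] :
    ∃ π : ∀ i, A i, ∀ π', M.bellmanFixedPoint π ≤ M.bellman π' (M.bellmanFixedPoint π) := by
  -- A policy of least total value cannot be improved: the greedy improvement `ρ` has pointwise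
  -- smaller or equal values, hence equal ones.
  obtain ⟨π, hπ⟩ := Finite.exists_min fun π : ∀ i, A i => ∑ i, M.bellmanFixedPoint π i
  obtain ⟨ρ, hρ⟩ := M.exists_bellman_le (M.bellmanFixedPoint π)
  have hle : M.bellmanFixedPoint ρ ≤ M.bellmanFixedPoint π :=
    M.bellmanFixedPoint_le ρ ((hρ π).trans_eq (M.bellman_bellmanFixedPoint π))
  have heq : M.bellmanFixedPoint ρ = M.bellmanFixedPoint π := by
    have h := (Finset.sum_eq_sum_iff_of_le fun i _ => hle i).1
      (le_antisymm (Finset.sum_le_sum fun i _ => hle i) (hπ ρ))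
    exact funext fun i => h i (Finset.mem_univ i)
  refine ⟨π, fun π' => ?_⟩
  calc M.bellmanFixedPoint π = M.bellman ρ (M.bellmanFixedPoint π) := by
        rw [← heq, bellman_bellmanFixedPoint]
    _ ≤ _ := hρ π'

end BellmanOperators

/-! ### Levels of the reachability graph -/

variable {M}

theorem IsAbsorbing.eq_of_edge {i j : S} (hi : M.IsAbsorbing i) (h : M.Edge i j) : j = i := by
  obtain ⟨u, hu⟩ := h
  have := (PMF.apply_eq_one_iff _ _).1 (hi u)
  have hj : j ∈ (M.P i u).support := (PMF.mem_support_iff _ _).2 hu.ne'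
  rwa [this] at hj

/-- The edges between transient states. -/
def TransientEdge (M : DiscountedMDP S A) (a b : S) : Prop :=
  M.IsTransient a ∧ M.IsTransient b ∧ M.Edge a b

theorem exists_edge [∀ i, Nonempty (A i)] (i : S) : ∃ j, M.Edge i j := by
  obtain ⟨u⟩ := ‹∀ i, Nonempty (A i)› i
  obtain ⟨j, hj⟩ := (M.P i u).support_nonempty
  exact ⟨j, u, pos_iff_ne_zero.2 ((PMF.mem_support_iff _ _).1 hj)⟩

/-- No edge leaves an absorbing state for another state, so a path that ends at a transient state is
transient throughout. -/
theorem transientEdge_of_reaches (h_absorbing : ∀ i, ¬ M.IsTransient i → M.IsAbsorbing i)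
    {a i : S} (hi : M.IsTransient i) (h : M.Reaches a i) :
    M.IsTransient a ∧ Relation.ReflTransGen M.TransientEdge a i := by
  induction h using Relation.ReflTransGen.head_induction_on with
  | refl => exact ⟨hi, .refl⟩
  | @head a b hab _ ih =>
    have ha : M.IsTransient a := by
      by_contra ha
      have := (h_absorbing a ha).eq_of_edge hab
      subst this
      exact ha ih.1
    exact ⟨ha, .head ⟨ha, ih.1, hab⟩ ih.2⟩

theorem not_reaches_of_edge (h_acyclic : M.TransientAcyclic)
    (h_absorbing : ∀ i, ¬ M.IsTransient i → M.IsAbsorbing i)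
    {i j : S} (hi : M.IsTransient i) (hij : M.Edge i j) : ¬ M.Reaches j i := fun h => by
  obtain ⟨hj, hji⟩ := transientEdge_of_reaches h_absorbing hi h
  exact h_acyclic i (Relation.TransGen.head' ⟨hi, hj, hij⟩ hji)

theorem reaches_of_path {l : ℕ} {x : Fin (l + 1) → S}
    (hx : ∀ m : Fin l, M.Edge (x m.castSucc) (x m.succ)) (m : Fin (l + 1)) :
    M.Reaches (x 0) (x m) := by
  induction m using Fin.induction with
  | zero => exact .refl
  | succ m ih => exact ih.tail (hx m)

theorem PathToAbsorbing.cons (h_acyclic : M.TransientAcyclic)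
    (h_absorbing : ∀ i, ¬ M.IsTransient i → M.IsAbsorbing i)
    {i j : S} (hi : M.IsTransient i) (hij : M.Edge i j) {l : ℕ} (h : M.PathToAbsorbing j l) :
    M.PathToAbsorbing i (l + 1) := by
  obtain ⟨x, hx, hx0, hxl, hxe⟩ := h
  refine ⟨Fin.cons i x, Fin.cons_injective_iff.2 ⟨?_, hx⟩, by simp, ?_, fun m => ?_⟩
  -- A repetition of `i` on the path from `j` would close a cycle through the edge from `i` to `j`.
  · rintro ⟨m, hm⟩
    refine not_reaches_of_edge h_acyclic h_absorbing hi hij ?_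
    rw [← hx0, ← hm]
    exact reaches_of_path hxe m
  · rw [← Fin.succ_last, Fin.cons_succ]
    exact hxl
  · induction m using Fin.cases with
    | zero => simpa [hx0] using hij
    | succ m =>
      rw [← Fin.succ_castSucc, Fin.cons_succ, Fin.cons_succ]
      exact hxe m

theorem IsAbsorbing.pathToAbsorbing_zero {i : S} (hi : M.IsAbsorbing i) :
    M.PathToAbsorbing i 0 :=
  ⟨fun _ => i, fun a b _ => Subsingleton.elim (α := Fin 1) a b, rfl, hi, fun m => m.elim0⟩

theorem bddAbove_pathToAbsorbing [Fintype S] (i : S) : BddAbove {l | M.PathToAbsorbing i l} := by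
  refine ⟨Fintype.card S, fun l ⟨x, hx, _⟩ => ?_⟩
  have := Fintype.card_le_of_injective x hx
  rw [Fintype.card_fin] at this
  omega

section Levels

variable [Fintype S] [∀ i, Nonempty (A i)]

theorem exists_pathToAbsorbing (h_acyclic : M.TransientAcyclic)
    (h_absorbing : ∀ i, ¬ M.IsTransient i → M.IsAbsorbing i) (i : S) :
    ∃ l, M.PathToAbsorbing i l := by
  have : Std.Irrefl (Relation.TransGen (Function.swap M.TransientEdge)) :=
    ⟨fun a h => h_acyclic a (Relation.transGen_swap.1 h)⟩
  have hwf : WellFounded (Relation.TransGen (Function.swap M.TransientEdge)) :=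
    Finite.wellFounded_of_trans_of_irrefl _
  induction i using hwf.induction with
  | _ i ih =>
    by_cases hi : M.IsTransient i
    · obtain ⟨j, hij⟩ := M.exists_edge i
      suffices h : ∃ l, M.PathToAbsorbing j l by
        obtain ⟨l, hl⟩ := h
        exact ⟨l + 1, hl.cons h_acyclic h_absorbing hi hij⟩
      by_cases hj : M.IsTransient j
      · exact ih j (.single ⟨hi, hj, hij⟩)
      · exact ⟨0, (h_absorbing j hj).pathToAbsorbing_zero⟩
    · exact ⟨0, (h_absorbing i hi).pathToAbsorbing_zero⟩

/-- The maximum distance to an absorbing state decreases along the edges that leave transient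
states. -/
theorem maxDist_lt_of_edge (h_acyclic : M.TransientAcyclic)
    (h_absorbing : ∀ i, ¬ M.IsTransient i → M.IsAbsorbing i)
    {i j : S} (hi : M.IsTransient i) (hij : M.Edge i j) : M.maxDist j < M.maxDist i := by
  -- The supremum is attained because the set of lengths is nonempty and bounded; otherwise `sSup`
  -- on `ℕ` would return the default value `0`.
  have h : M.PathToAbsorbing j (M.maxDist j) :=
    Nat.sSup_mem (exists_pathToAbsorbing h_acyclic h_absorbing j) (bddAbove_pathToAbsorbing j)
  exact le_csSup (bddAbove_pathToAbsorbing i) (h.cons h_acyclic h_absorbing hi hij)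

end Levels

end DiscountedMDP

namespace DiscountedMDP

variable {S : Type*} {A : S → Type*} (M : DiscountedMDP S A) {k : ℕ} (cl : S → Fin k)

/-! ### The first visit to a cluster -/

/-- Freeze the path after time `m`. The resulting function has a finite domain, which makes its
measurability and integrability automatic. -/
theorem exists_eq_comp_restrict {w : (ℕ → S) → ℝ} {m : ℕ}
    (hw : ∀ x y : ℕ → S, (∀ n ≤ m, x n = y n) → w x = w y) :
    ∃ g : (Finset.Iic m → S) → ℝ, ∀ x, w x = g fun n => x n := by
  refine ⟨fun h => w fun n => h ⟨min n m, Finset.mem_Iic.2 (min_le_right _ _)⟩, fun x => ?_⟩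
  exact hw _ _ fun n hn => by simp [hn]

theorem Visits.cl_firstVisit {cl : S → Fin k} {x : ℕ → S} {c : Fin k} (h : Visits cl x c) :
    cl (x (firstVisit cl x c)) = c :=
  Nat.sInf_mem (s := {m | cl (x m) = c}) h

theorem firstVisit_le {cl : S → Fin k} {x : ℕ → S} {c : Fin k} {n : ℕ} (h : cl (x n) = c) :
    firstVisit cl x c ≤ n :=
  Nat.sInf_le h

open Classical in
/-- The weight `α ^ (m - N)` if the first visit to `c` happens at a time `N ≤ m`, else zero. -/
noncomputable def visitWeight (c : Fin k) (m : ℕ) (x : ℕ → S) : ℝ :=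
  if ∃ n ≤ m, cl (x n) = c then M.discount ^ (m - firstVisit cl x c) else 0

/-- Whether `c` has been visited by time `m`, and when first, can be read off the path up to time
`m`. This adaptedness is what lets the weights multiply centred errors. -/
theorem visitWeight_congr (c : Fin k) (m : ℕ) (x y : ℕ → S) (h : ∀ n ≤ m, x n = y n) :
    M.visitWeight cl c m x = M.visitWeight cl c m y := by
  have hiff : (∃ n ≤ m, cl (x n) = c) ↔ ∃ n ≤ m, cl (y n) = c :=
    exists_congr fun n => and_congr_right fun hn => by rw [h n hn]
  unfold visitWeight
  by_cases hx : ∃ n ≤ m, cl (x n) = c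
  · have hy := hiff.1 hx
    rw [if_pos hx, if_pos hy]
    obtain ⟨n, hn, hxn⟩ := hx
    obtain ⟨n', hn', hyn⟩ := hy
    have h1 := (firstVisit_le hxn).trans hn
    have h2 := (firstVisit_le hyn).trans hn'
    have e : firstVisit cl x c = firstVisit cl y c := by
      refine le_antisymm (firstVisit_le ?_) (firstVisit_le ?_)
      · rw [h _ h2]
        exact Visits.cl_firstVisit ⟨n', hyn⟩
      · rw [← h _ h1]
        exact Visits.cl_firstVisit ⟨n, hxn⟩
    rw [e]
  · rw [if_neg hx, if_neg (hiff.not.1 hx)]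

theorem visitWeight_of_lt {c : Fin k} {m : ℕ} {x : ℕ → S} (h : m < firstVisit cl x c) :
    M.visitWeight cl c m x = 0 :=
  if_neg fun ⟨_, hn, hx⟩ => ((firstVisit_le hx).trans hn).not_gt h

theorem visitWeight_add {c : Fin k} {x : ℕ → S} (h : Visits cl x c) (m : ℕ) :
    M.visitWeight cl c (firstVisit cl x c + m) x = M.discount ^ m := by
  rw [visitWeight, if_pos ⟨_, Nat.le_add_right _ _, h.cl_firstVisit⟩, Nat.add_sub_cancel_left]

theorem visitWeight_of_not_visits {c : Fin k} {x : ℕ → S} (h : ¬ Visits cl x c) (m : ℕ) :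
    M.visitWeight cl c m x = 0 :=
  if_neg fun ⟨n, _, hx⟩ => h ⟨n, hx⟩

theorem sum_visitWeight_mul {c : Fin k} {x : ℕ → S} (h : Visits cl x c) (f : ℕ → ℝ) (n : ℕ) :
    ∑ m ∈ Finset.range (firstVisit cl x c + n), M.visitWeight cl c m x * f m =
      ∑ m ∈ Finset.range n, M.discount ^ m * f (firstVisit cl x c + m) := by
  rw [Finset.sum_range_add, Finset.sum_eq_zero, zero_add]
  · simp only [M.visitWeight_add cl h]
  · intro m hm
    rw [M.visitWeight_of_lt cl (Finset.mem_range.1 hm), zero_mul]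

theorem visitWeight_nonneg (c : Fin k) (m : ℕ) (x : ℕ → S) : 0 ≤ M.visitWeight cl c m x := by
  unfold visitWeight
  split_ifs
  · exact pow_nonneg M.discount_pos.le _
  · exact le_rfl

theorem sum_abs_visitWeight_le (c : Fin k) (n : ℕ) (x : ℕ → S) :
    ∑ m ∈ Finset.range n, |M.visitWeight cl c m x| ≤ (1 - M.discount)⁻¹ := by
  simp only [abs_of_nonneg (M.visitWeight_nonneg cl c _ x)]
  by_cases h : Visits cl x c
  · calc ∑ m ∈ Finset.range n, M.visitWeight cl c m x
        ≤ ∑ m ∈ Finset.range (firstVisit cl x c + n), M.visitWeight cl c m x :=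
          Finset.sum_le_sum_of_subset_of_nonneg
            (Finset.range_subset_range.2 (Nat.le_add_left _ _))
            fun m _ _ => M.visitWeight_nonneg cl c m x
      _ = ∑ m ∈ Finset.range n, M.discount ^ m := by
          simpa using M.sum_visitWeight_mul cl h (fun _ => 1) n
      _ ≤ ∑' m, M.discount ^ m :=
          (summable_geometric_of_lt_one M.discount_pos.le M.discount_lt_one).sum_le_tsum _
            fun m _ => pow_nonneg M.discount_pos.le m
      _ = (1 - M.discount)⁻¹ := tsum_geometric_of_lt_one M.discount_pos.le M.discount_lt_one
  · simp only [M.visitWeight_of_not_visits cl h, Finset.sum_const_zero]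
    exact inv_nonneg.2 (sub_nonneg.2 M.discount_lt_one.le)

/-! ### One-step errors of the value function -/

section StepError

variable [Fintype S]

/-- The one-step error `c(x_m) + α J(x_{m+1}) - J(x_m)` for the value function `J` of `π`. -/
noncomputable def stepError (π : ∀ i, A i) (m : ℕ) (x : ℕ → S) : ℝ :=
  M.cost (x m) (π (x m)) + M.discount * M.bellmanFixedPoint π (x (m + 1))
    - M.bellmanFixedPoint π (x m)

theorem exists_bound_stepError (π : ∀ i, A i) : ∃ C, 0 ≤ C ∧ ∀ m x, |M.stepError π m x| ≤ C := by
  obtain ⟨C, hC⟩ := (Set.finite_range fun q : S × S => |M.cost q.1 (π q.1)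
    + M.discount * M.bellmanFixedPoint π q.2 - M.bellmanFixedPoint π q.1|).bddAbove
  exact ⟨max C 0, le_max_right _ _, fun m x =>
    (hC ⟨(x m, x (m + 1)), rfl⟩).trans (le_max_left _ _)⟩

/-- The values telescope, and the boundary term is a bounded value times `discount ^ n`. -/
theorem tendsto_sum_stepError (π : ∀ i, A i) (N : ℕ) (x : ℕ → S) :
    Tendsto (fun n => ∑ m ∈ Finset.range n, M.discount ^ m * M.stepError π (N + m) x) atTop
      (𝓝 (M.costFrom π N x - M.bellmanFixedPoint π (x N))) := by
  have h1 : ∀ n, ∑ m ∈ Finset.range n, M.discount ^ m * M.stepError π (N + m) x =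
      ∑ m ∈ Finset.range n, M.discount ^ m * M.cost (x (N + m)) (π (x (N + m)))
        + M.discount ^ n * M.bellmanFixedPoint π (x (N + n))
        - M.bellmanFixedPoint π (x N) := by
    intro n
    induction n with
    | zero => simp
    | succ n ih =>
      rw [Finset.sum_range_succ, Finset.sum_range_succ, ih, stepError, pow_succ, add_assoc N n 1]
      ring
  have hgeom := summable_geometric_of_lt_one M.discount_pos.le M.discount_lt_one
  have hpow := tendsto_pow_atTop_nhds_zero_of_lt_one M.discount_pos.le M.discount_lt_one
  obtain ⟨B, hB⟩ := (Set.finite_range fun i => |M.bellmanFixedPoint π i|).bddAbove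
  obtain ⟨C, hC⟩ := (Set.finite_range fun i => M.cost i (π i)).bddAbove
  have h2 : Tendsto (fun n => M.discount ^ n * M.bellmanFixedPoint π (x (N + n))) atTop (𝓝 0) := by
    refine squeeze_zero_norm (fun n => ?_) (by simpa using hpow.mul_const B)
    rw [Real.norm_eq_abs, abs_mul, abs_of_nonneg (pow_nonneg M.discount_pos.le n)]
    exact mul_le_mul_of_nonneg_left (hB ⟨_, rfl⟩) (pow_nonneg M.discount_pos.le n)
  have h3 : Summable fun m => M.discount ^ m * M.cost (x (N + m)) (π (x (N + m))) := by
    refine Summable.of_nonneg_of_le (fun m => mul_nonneg (pow_nonneg M.discount_pos.le m)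
      (M.cost_nonneg _ _)) (fun m => ?_) (hgeom.mul_right C)
    exact mul_le_mul_of_nonneg_left (hC ⟨x (N + m), rfl⟩) (pow_nonneg M.discount_pos.le m)
  simp only [h1]
  simpa [costFrom] using (h3.hasSum.tendsto_sum_nat.add h2).sub_const _

open Classical in
/-- The deviation of the tail cost from its conditional mean, zero without a visit to `c`. -/
noncomputable def visitNoise (c : Fin k) (π : ∀ i, A i) (x : ℕ → S) : ℝ :=
  if Visits cl x c then
    M.tailCost cl π x c - M.bellmanFixedPoint π (x (firstVisit cl x c)) else 0

/-- Spreading the discount factors over deterministic times turns a sum that starts at a random time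
into a series with adapted weights. This does the work of the strong Markov property. -/
theorem tendsto_visitNoise (c : Fin k) (π : ∀ i, A i) (x : ℕ → S) :
    Tendsto (fun n => ∑ m ∈ Finset.range n, M.visitWeight cl c m x * M.stepError π m x) atTop
      (𝓝 (M.visitNoise cl c π x)) := by
  unfold visitNoise
  split_ifs with h
  · rw [← tendsto_add_atTop_iff_nat (firstVisit cl x c)]
    simp only [add_comm _ (firstVisit cl x c), M.sum_visitWeight_mul cl h]
    exact M.tendsto_sum_stepError π _ x
  · simp [M.visitWeight_of_not_visits cl h]

end StepError

/-! ### Integrals over trajectories -/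

section Trajectories

variable [Fintype S] [MeasurableSpace S] [MeasurableSingletonClass S]

instance (π : ∀ i, A i) (i : S) : IsProbabilityMeasure (M.trajLaw π i) := by
  unfold trajLaw
  infer_instance

instance (p : PMF S) (π : ∀ i, A i) : IsProbabilityMeasure (M.chainLaw p π) := by
  refine ⟨?_⟩
  have h := p.tsum_coe
  rw [tsum_fintype] at h
  simp [chainLaw, h]

theorem integral_stepKernel (π : ∀ i, A i) (i : S) (g : S → ℝ) :
    ∫ j, g j ∂(M.stepKernel π i) = ∑ j, (M.P i (π i) j).toReal * g j := by
  change ∫ j, g j ∂(M.P i (π i)).toMeasure = _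
  rw [PMF.integral_eq_sum]
  rfl

/-- Given the past up to time `m`, a function of the past and the next state integrates to zero
if it has mean zero under the transition probabilities. -/
theorem integral_trajLaw_eq_zero (π : ∀ i, A i) (i : S) (m : ℕ)
    {H : (Finset.Iic m → S) → S → ℝ}
    (hH : ∀ h, ∑ j, (M.P (h ⟨m, Finset.mem_Iic.2 le_rfl⟩) (π _) j).toReal * H h j = 0) :
    ∫ x, H (fun n => x n) (x (m + 1)) ∂(M.trajLaw π i) = 0 := by
  have hmap := Kernel.partialTraj_compProd_eq_map_traj (X := fun _ => S)
    (κ := M.historyKernel π) (Nat.zero_le m) (x₀ := fun _ => i)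
  have hmeas : Measurable fun x : ℕ → S =>
      (Preorder.frestrictLe (π := fun _ => S) m x, x (m + 1)) := by
    fun_prop
  have h1 : ∫ x, H (fun n => x n) (x (m + 1)) ∂(M.trajLaw π i)
      = ∫ y : (Finset.Iic m → S) × S, H y.1 y.2 ∂((M.trajLaw π i).map
        fun x : ℕ → S => (Preorder.frestrictLe (π := fun _ => S) m x, x (m + 1))) := by
    rw [integral_map hmeas.aemeasurable Integrable.of_finite.aestronglyMeasurable]
    rfl
  rw [h1, trajLaw, ← hmap, Measure.integral_compProd Integrable.of_finite]
  refine integral_eq_zero_of_ae (ae_of_all _ fun h => ?_)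
  exact (M.integral_stepKernel π _ (H h)).trans (hH h)

theorem trajLaw_zero_ae (π : ∀ i, A i) (i : S) : ∀ᵐ x ∂(M.trajLaw π i), x 0 = i := by
  have h := Kernel.traj_map_frestrictLe_apply (X := fun _ => S) (κ := M.historyKernel π) 0 0
    (fun _ => i)
  rw [Kernel.partialTraj_self, Kernel.id_apply] at h
  have h2 : ∀ᵐ y ∂((M.trajLaw π i).map (Preorder.frestrictLe (π := fun _ => S) 0)),
      y ⟨0, Finset.mem_Iic.2 le_rfl⟩ = i := by
    rw [trajLaw, h, ae_dirac_iff (MeasurableSet.of_discrete)]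
  exact ae_of_ae_map (Preorder.measurable_frestrictLe 0).aemeasurable h2

/-- The fixed point equation says exactly that the one-step error has mean zero given the current
state; a factor that depends on the past does not change this. -/
theorem integral_mul_stepError (π : ∀ i, A i) (i : S) (m : ℕ) {w : (ℕ → S) → ℝ}
    (hw : ∀ x y : ℕ → S, (∀ n ≤ m, x n = y n) → w x = w y) :
    ∫ x, w x * M.stepError π m x ∂(M.trajLaw π i) = 0 := by
  obtain ⟨g, hg⟩ := exists_eq_comp_restrict hw
  simp only [hg, stepError]
  refine M.integral_trajLaw_eq_zero π i m
    (H := fun h j => g h * (M.cost (h ⟨m, Finset.mem_Iic.2 le_rfl⟩) (π _)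
      + M.discount * M.bellmanFixedPoint π j
      - M.bellmanFixedPoint π (h ⟨m, Finset.mem_Iic.2 le_rfl⟩))) fun h => ?_
  set i := h ⟨m, Finset.mem_Iic.2 le_rfl⟩
  have h1 := congrFun (M.bellman_bellmanFixedPoint π) i
  rw [bellman] at h1
  have h2 := M.sum_toReal_P i (π i)
  calc ∑ j, (M.P i (π i) j).toReal * (g h * (M.cost i (π i)
        + M.discount * M.bellmanFixedPoint π j - M.bellmanFixedPoint π i))
      = g h * ((M.cost i (π i) - M.bellmanFixedPoint π i) * ∑ j, (M.P i (π i) j).toReal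
        + M.discount * ∑ j, (M.P i (π i) j).toReal * M.bellmanFixedPoint π j) := by
        rw [mul_add, Finset.mul_sum, Finset.mul_sum, Finset.mul_sum, Finset.mul_sum,
          ← Finset.sum_add_distrib]
        exact Finset.sum_congr rfl fun j _ => by ring
    _ = 0 := by rw [h2, mul_one]; linear_combination g h * h1

theorem measurable_stepError (π : ∀ i, A i) (m : ℕ) : Measurable (M.stepError π m) := by
  have h1 : Measurable fun i => M.cost i (π i) := .of_discrete
  have h2 : Measurable (M.bellmanFixedPoint π) := .of_discrete
  unfold stepError
  exact ((h1.comp (measurable_pi_apply m)).add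
    ((h2.comp (measurable_pi_apply (m + 1))).const_mul _)).sub (h2.comp (measurable_pi_apply m))

/-- A weighted series of one-step errors, with weights that depend on the past, is bounded and
has mean zero. -/
theorem integral_eq_zero_of_tendsto_sum_stepError (π : ∀ i, A i) {w : ℕ → (ℕ → S) → ℝ}
    (hw : ∀ m (x y : ℕ → S), (∀ n ≤ m, x n = y n) → w m x = w m y) {K : ℝ}
    (hK : ∀ n x, ∑ m ∈ Finset.range n, |w m x| ≤ K) {F : (ℕ → S) → ℝ}
    (hF : ∀ x, Tendsto (fun n => ∑ m ∈ Finset.range n, w m x * M.stepError π m x) atTop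
      (𝓝 (F x))) :
    Measurable F ∧ (∃ C, ∀ x, |F x| ≤ C) ∧ ∀ i, ∫ x, F x ∂(M.trajLaw π i) = 0 := by
  obtain ⟨C, hC0, hC⟩ := M.exists_bound_stepError π
  have hwm : ∀ m, Measurable (w m) := fun m => by
    obtain ⟨g, hg⟩ := exists_eq_comp_restrict (hw m)
    have h1 : Measurable g := .of_discrete
    have h2 : w m = fun x => g fun n => x n := funext hg
    rw [h2]
    exact h1.comp (measurable_pi_lambda _ fun n => measurable_pi_apply _)
  have htm : ∀ m, Measurable fun x => w m x * M.stepError π m x := fun m =>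
    (hwm m).mul (M.measurable_stepError π m)
  have hsm : ∀ n, Measurable fun x => ∑ m ∈ Finset.range n, w m x * M.stepError π m x :=
    fun n => Finset.measurable_sum _ fun m _ => htm m
  have hbound : ∀ n x, |∑ m ∈ Finset.range n, w m x * M.stepError π m x| ≤ K * C := by
    intro n x
    calc |∑ m ∈ Finset.range n, w m x * M.stepError π m x|
        ≤ ∑ m ∈ Finset.range n, |w m x| * C := by
          refine (Finset.abs_sum_le_sum_abs _ _).trans (Finset.sum_le_sum fun m _ => ?_)
          rw [abs_mul]
          exact mul_le_mul_of_nonneg_left (hC m x) (abs_nonneg _)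
      _ ≤ K * C := by
          rw [← Finset.sum_mul]
          exact mul_le_mul_of_nonneg_right (hK n x) hC0
  refine ⟨measurable_of_tendsto_metrizable hsm (tendsto_pi_nhds.2 hF),
    ⟨K * C, fun x => le_of_tendsto (hF x).abs (.of_forall fun n => hbound n x)⟩, fun i => ?_⟩
  have hlim := tendsto_integral_of_dominated_convergence (μ := M.trajLaw π i)
    (F := fun n x => ∑ m ∈ Finset.range n, w m x * M.stepError π m x) (f := F)
    (fun _ => K * C) (fun n => (hsm n).aestronglyMeasurable) (integrable_const _)
    (fun n => ae_of_all _ (hbound n)) (ae_of_all _ hF)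
  have hzero : ∀ n,
      ∫ x, ∑ m ∈ Finset.range n, w m x * M.stepError π m x ∂(M.trajLaw π i) = 0 := by
    intro n
    rw [integral_finsetSum]
    · exact Finset.sum_eq_zero fun m _ => M.integral_mul_stepError π i m (hw m)
    · intro m _
      refine Integrable.of_bound (htm m).aestronglyMeasurable (K * C) (ae_of_all _ fun x => ?_)
      rw [Real.norm_eq_abs, abs_mul]
      have hwK : |w m x| ≤ K := (Finset.single_le_sum (f := fun m => |w m x|)
        (fun _ _ => abs_nonneg _)
        (Finset.self_mem_range_succ m)).trans (hK (m + 1) x)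
      exact mul_le_mul hwK (hC m x) (abs_nonneg _) ((abs_nonneg _).trans hwK)
  simp only [hzero] at hlim
  exact tendsto_nhds_unique hlim tendsto_const_nhds

theorem visitNoise_spec (c : Fin k) (π : ∀ i, A i) :
    Measurable (M.visitNoise cl c π) ∧ (∃ C, ∀ x, |M.visitNoise cl c π x| ≤ C) ∧
      ∀ i, ∫ x, M.visitNoise cl c π x ∂(M.trajLaw π i) = 0 :=
  M.integral_eq_zero_of_tendsto_sum_stepError π (M.visitWeight_congr cl c)
    (M.sum_abs_visitWeight_le cl c) (M.tendsto_visitNoise cl c π)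

theorem integral_visitNoise (c : Fin k) (p : PMF S) (π : ∀ i, A i) :
    ∫ x, M.visitNoise cl c π x ∂(M.chainLaw p π) = 0 := by
  obtain ⟨hm, ⟨C, hC⟩, h0⟩ := M.visitNoise_spec cl c π
  rw [chainLaw, integral_finsetSum_measure]
  · simp [integral_smul_measure, h0]
  · intro i _
    exact (Integrable.of_bound hm.aestronglyMeasurable C (ae_of_all _ hC)).smul_measure
      (p.apply_ne_top i)

/-- The expected discounted cost is the fixed point of the Bellman operator. -/
theorem value_eq_bellmanFixedPoint (π : ∀ i, A i) (i : S) :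
    M.value π i = M.bellmanFixedPoint π i := by
  -- With a single cluster the first visit is at time `0`, so the centred noise is the total cost
  -- minus the fixed point at the initial state.
  have hv : ∀ x : ℕ → S, Visits (fun _ => (0 : Fin 1)) x 0 := fun x => ⟨0, rfl⟩
  have hf : ∀ x : ℕ → S, firstVisit (fun _ => (0 : Fin 1)) x 0 = 0 := fun x =>
    Nat.le_zero.1 (firstVisit_le (n := 0) rfl)
  obtain ⟨hm, ⟨C, hC⟩, h0⟩ := M.visitNoise_spec (fun _ => (0 : Fin 1)) 0 π
  have e : ∀ x, M.visitNoise (fun _ => (0 : Fin 1)) 0 π x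
      = M.costFrom π 0 x - M.bellmanFixedPoint π (x 0) := fun x => by
    rw [visitNoise, if_pos (hv x), tailCost, hf x]
  have hi := Integrable.of_bound (μ := M.trajLaw π i) hm.aestronglyMeasurable C (ae_of_all _ hC)
  have h1 : M.costFrom π 0 =ᵐ[M.trajLaw π i] fun x =>
      M.visitNoise (fun _ => (0 : Fin 1)) 0 π x + M.bellmanFixedPoint π i := by
    filter_upwards [M.trajLaw_zero_ae π i] with x hx
    rw [e, hx]
    ring
  rw [value, integral_congr_ae h1, integral_add hi (integrable_const _), h0]
  simp

theorem measurableSet_visits (c : Fin k) : MeasurableSet {x : ℕ → S | Visits cl x c} := by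
  have : {x : ℕ → S | Visits cl x c} = ⋃ m, (fun x : ℕ → S => x m) ⁻¹' {i | cl i = c} := by
    ext x
    simp [Visits]
  rw [this]
  exact .iUnion fun m => measurable_pi_apply m (.of_discrete)

end Trajectories

end DiscountedMDP

namespace DiscountedMDP

variable {S : Type*} {A : S → Type*} {M : DiscountedMDP S A}

/-! ### Counting visits -/

section VisitCount

variable {k : ℕ} {cl : S → Fin k}

open Classical in
theorem visitCount_eq_sum (x : ℕ → ℕ → S) (t : ℕ) (c : Fin k) :
    visitCount cl x t c = ∑ τ ∈ Finset.range t, if Visits cl (x τ) c then 1 else 0 := by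
  have : {τ | τ < t ∧ Visits cl (x τ) c} =
      ((Finset.range t).filter fun τ => Visits cl (x τ) c : Finset ℕ) := by
    ext τ
    simp
  rw [visitCount, this, Set.ncard_coe_finset, Finset.card_filter]

-- The visit count increases exactly at the visits, so these run through the indices `0, 1, 2, …`
-- once each.
open Classical in
theorem sum_visits_comp_visitCount (x : ℕ → ℕ → S) (c : Fin k) (g : ℕ → ℝ) (n : ℕ) :
    (∑ t ∈ Finset.range n, if Visits cl (x t) c then g (visitCount cl x t c) else 0) =
      ∑ j ∈ Finset.range (visitCount cl x n c), g j := by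
  induction n with
  | zero => simp [visitCount_eq_sum]
  | succ n ih =>
    rw [Finset.sum_range_succ, ih, visitCount_eq_sum x (n + 1), Finset.sum_range_succ,
      ← visitCount_eq_sum]
    split_ifs
    · rw [Finset.sum_range_succ]
    · simp

-- Restricting to visits is essential for the second rule: between visits the step size keeps
-- repeating the same value of `β`.
open Classical in
theorem sum_sq_stepSize_le {Ω : Type*} {X : ℕ → Ω → ℕ → S} {γ : ℕ → Ω → Fin k → ℝ} {β : ℕ → ℝ}
    (hβ_sq : Summable fun t => β t ^ 2)
    (h_step : (∀ t ω c, γ t ω c = β t) ∨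
      (∀ t ω c, γ t ω c = β (visitCount cl (fun τ => X τ ω) t c))) (c : Fin k) (n : ℕ) (ω : Ω) :
    (∑ t ∈ Finset.range n, if Visits cl (X t ω) c then γ t ω c ^ 2 else 0) ≤ ∑' t, β t ^ 2 := by
  rcases h_step with h | h
  · refine (Finset.sum_le_sum fun t _ => ?_).trans
      (hβ_sq.sum_le_tsum (Finset.range n) fun _ _ => sq_nonneg _)
    rw [h]
    split_ifs
    · exact le_rfl
    · exact sq_nonneg _
  · simp only [h]
    rw [sum_visits_comp_visitCount (fun τ => X τ ω) c (fun j => β j ^ 2)]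
    exact hβ_sq.sum_le_tsum _ fun _ _ => sq_nonneg _

end VisitCount

/-! ### The optimal value function -/

section OptValue

variable [Fintype S]

theorem IsAbsorbing.bellman_eq {i : S} (hi : M.IsAbsorbing i) (π : ∀ i, A i) (J : S → ℝ) :
    M.bellman π J i = M.cost i (π i) + M.discount * J i := by
  rw [bellman, Finset.sum_eq_single i]
  · rw [hi (π i), ENNReal.toReal_one, one_mul]
  · intro j _ hj
    have h0 : M.P i (π i) j = 0 := by
      by_contra h
      exact hj (hi.eq_of_edge ⟨π i, pos_iff_ne_zero.2 h⟩)
    simp [h0]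
  · simp

theorem bellman_congr_of_edge {π : ∀ i, A i} {i : S} {J J' : S → ℝ}
    (h : ∀ j, M.Edge i j → J j = J' j) : M.bellman π J i = M.bellman π J' i := by
  unfold bellman
  congr 2
  refine Finset.sum_congr rfl fun j _ => ?_
  by_cases h0 : M.P i (π i) j = 0
  · simp [h0]
  · rw [h j ⟨π i, pos_iff_ne_zero.2 h0⟩]

theorem tendsto_bellman_of_edge {π : ∀ i, A i} {i : S} {J : ℕ → S → ℝ} {J' : S → ℝ}
    (h : ∀ j, M.Edge i j → Tendsto (fun t => J t j) atTop (𝓝 (J' j))) :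
    Tendsto (fun t => M.bellman π (J t) i) atTop (𝓝 (M.bellman π J' i)) := by
  unfold bellman
  refine tendsto_const_nhds.add (Tendsto.const_mul _ (tendsto_finsetSum _ fun j _ => ?_))
  by_cases h0 : M.P i (π i) j = 0
  · simp [h0]
  · exact (h j ⟨π i, pos_iff_ne_zero.2 h0⟩).const_mul _

variable [MeasurableSpace S] [MeasurableSingletonClass S]
  [∀ i, Nonempty (A i)]

/-- A policy that attains the minimum in the optimality equation at all states up to level `d`
is optimal there. -/
theorem bellmanFixedPoint_eq_optValue (h_acyclic : M.TransientAcyclic)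
    (h_absorbing : ∀ i, ¬ M.IsTransient i → M.IsAbsorbing i) {d : ℕ} {π : ∀ i, A i}
    (hπ : ∀ j, M.maxDist j ≤ d → M.bellman π M.optValue j = M.optValue j) (j : S)
    (hj : M.maxDist j ≤ d) : M.bellmanFixedPoint π j = M.optValue j := by
  induction h : M.maxDist j using Nat.strong_induction_on generalizing j with
  | _ e ih =>
    have h1 := congrFun (M.bellman_bellmanFixedPoint π) j
    have h2 := hπ j hj
    by_cases ht : M.IsTransient j
    · rw [← h1, ← h2]
      refine bellman_congr_of_edge fun j' hjj' => ?_
      have hlt := maxDist_lt_of_edge h_acyclic h_absorbing ht hjj'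
      exact ih _ (h ▸ hlt) j' (hlt.le.trans hj) rfl
    · have ha := h_absorbing j ht
      rw [ha.bellman_eq] at h1 h2
      have h3 : (1 - M.discount) * (M.bellmanFixedPoint π j - M.optValue j) = 0 := by
        linear_combination h2 - h1
      rcases mul_eq_zero.1 h3 with h4 | h4
      · linarith [M.discount_lt_one]
      · linarith

variable [∀ i, Finite (A i)]

/-- The Bellman optimality equation. -/
theorem optValue_isFixedPt (M : DiscountedMDP S A) :
    (∃ π, M.bellman π M.optValue = M.optValue) ∧ ∀ π, M.optValue ≤ M.bellman π M.optValue := by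
  obtain ⟨π, hπ⟩ := M.exists_optimal_policy
  -- The fixed point of `π` lies below its image under every Bellman operator, hence below the value
  -- of every policy.
  have : M.optValue = M.bellmanFixedPoint π := by
    ext i
    simp only [optValue, value_eq_bellmanFixedPoint]
    exact le_antisymm (ciInf_le (Set.finite_range _).bddBelow π)
      (le_ciInf fun π' => M.le_bellmanFixedPoint π' (hπ π') i)
  rw [this]
  exact ⟨⟨π, M.bellman_bellmanFixedPoint π⟩, hπ⟩

/-- Policies that are greedy for value functions which converge to `J^*` below level `d` are
eventually optimal up to level `d`. -/
theorem eventually_bellmanFixedPoint_eq_optValue (h_acyclic : M.TransientAcyclic)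
    (h_absorbing : ∀ i, ¬ M.IsTransient i → M.IsAbsorbing i) {d : ℕ} {J : ℕ → S → ℝ}
    {μ : ℕ → ∀ i, A i} (hμ : ∀ t π, M.bellman (μ t) (J t) ≤ M.bellman π (J t))
    (hJ : ∀ j, M.maxDist j < d → Tendsto (fun t => J t j) atTop (𝓝 (M.optValue j))) :
    ∀ᶠ t in atTop, ∀ j, M.maxDist j ≤ d → M.bellmanFixedPoint (μ t) j = M.optValue j := by
  obtain ⟨⟨ρ, hρ⟩, hopt⟩ := M.optValue_isFixedPt
  suffices h : ∀ j, ∀ᶠ t in atTop, M.maxDist j ≤ d →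
      M.bellman (μ t) M.optValue j = M.optValue j by
    filter_upwards [eventually_all.2 h] with t ht
    exact bellmanFixedPoint_eq_optValue h_acyclic h_absorbing ht
  intro j
  by_cases hj : M.maxDist j ≤ d
  swap
  · exact .of_forall fun t h => absurd h hj
  suffices h : ∀ᶠ t in atTop, M.bellman (μ t) M.optValue j ≤ M.bellman ρ M.optValue j by
    filter_upwards [h] with t ht _
    exact le_antisymm (ht.trans_eq (congrFun hρ j)) (hopt _ j)
  by_cases ht : M.IsTransient j
  · have hlim : ∀ π, Tendsto (fun t => M.bellman π (J t) j) atTop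
        (𝓝 (M.bellman π M.optValue j)) := fun π => tendsto_bellman_of_edge fun j' hjj' =>
      hJ j' ((maxDist_lt_of_edge h_acyclic h_absorbing ht hjj').trans_le hj)
    -- A strict inequality between limits persists eventually, and finitely many policies allow a
    -- common time. A suboptimal choice at `j` would then contradict greediness.
    have hev : ∀ π, ∀ᶠ t in atTop, M.bellman ρ M.optValue j < M.bellman π M.optValue j →
        M.bellman ρ (J t) j < M.bellman π (J t) j := fun π => by
      by_cases hlt : M.bellman ρ M.optValue j < M.bellman π M.optValue j
      · filter_upwards [(hlim ρ).eventually_lt (hlim π) hlt] with t ht _ using ht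
      · exact .of_forall fun t h => absurd h hlt
    filter_upwards [eventually_all.2 hev] with t ht
    by_contra! hlt
    exact (ht _ hlt).not_ge (hμ t ρ j)
  -- The continuation term is `discount * J j` under both policies and cancels, so no convergence is
  -- needed here.
  · have ha := h_absorbing j ht
    refine .of_forall fun t => ?_
    have := hμ t ρ j
    rw [ha.bellman_eq, ha.bellman_eq] at this ⊢
    linarith

end OptValue

/-! ### Runs of the algorithm -/

section Runs

variable [Fintype S] [MeasurableSpace S] [MeasurableSingletonClass S]
  {k : ℕ} {cl : S → Fin k} {p : PMF S} {θ₀ : Fin k → ℝ}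
  {Ω : Type*} {mΩ : MeasurableSpace Ω} {Pr : Measure Ω}
  {ℱ : Filtration ℕ mΩ} {γ : ℕ → Ω → Fin k → ℝ} {μ : ℕ → Ω → ∀ i, A i} {X : ℕ → Ω → ℕ → S}
  {θ : ℕ → Ω → Fin k → ℝ} {β : ℕ → ℝ}

open Classical in
theorem IsAggregatedOPI.measurable_stepSize (h_run : M.IsAggregatedOPI cl p θ₀ Pr ℱ γ μ X θ)
    (h_step : (∀ t ω c, γ t ω c = β t) ∨
      (∀ t ω c, γ t ω c = β (visitCount cl (fun τ => X τ ω) t c))) (t : ℕ) (c : Fin k) :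
    Measurable[ℱ t] fun ω => γ t ω c := by
  rcases h_step with h | h
  · simp only [h]
    exact measurable_const
  · simp only [h, visitCount_eq_sum]
    have hβ : Measurable β := .of_discrete
    refine hβ.comp (Finset.measurable_sum (m := ℱ t) _ fun τ hτ => ?_)
    refine Measurable.ite ?_ measurable_const measurable_const
    exact ((h_run.traj_measurable τ).mono
      (ℱ.mono (Nat.succ_le_of_lt (Finset.mem_range.1 hτ))) le_rfl) (measurableSet_visits cl c)

/-- On an event of the past on which the policy is `π`, the trajectory is independent of the
event and distributed as the chain induced by `π`. -/
theorem IsAggregatedOPI.map_restrict [IsProbabilityMeasure Pr]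
    (h_run : M.IsAggregatedOPI cl p θ₀ Pr ℱ γ μ X θ) (t : ℕ)
    {D : Set Ω} (hD : MeasurableSet[ℱ t] D) {π : ∀ i, A i} (hπ : ∀ ω ∈ D, μ t ω = π) :
    (Pr.restrict D).map (X t) = Pr D • M.chainLaw p π := by
  have hX : Measurable (X t) := (h_run.traj_measurable t).mono (ℱ.le _) le_rfl
  ext B hB
  rw [Measure.map_apply hX hB, Measure.restrict_apply (hX hB), Measure.smul_apply, smul_eq_mul]
  have h1 := setIntegral_condExp (ℱ.le t) (μ := Pr) (f := (X t ⁻¹' B).indicator fun _ => (1 : ℝ))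
    ((integrable_const _).indicator (hX hB)) hD
  rw [setIntegral_congr_ae (ℱ.le t _ hD) ((h_run.traj_law t B hB).mono fun ω h _ => h),
    setIntegral_congr_fun (g := fun _ => (M.chainLaw p π).real B) (ℱ.le t _ hD)
      (fun ω hω => by simp only [hπ ω hω]),
    setIntegral_const, integral_indicator_const _ (hX hB)] at h1
  rw [measureReal_restrict_apply (hX hB), smul_eq_mul, smul_eq_mul, mul_one] at h1
  rw [← ENNReal.toReal_eq_toReal_iff' (measure_ne_top _ _)
    (ENNReal.mul_ne_top (measure_ne_top _ _) (measure_ne_top _ _)), ENNReal.toReal_mul]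
  exact h1.symm

variable [∀ i, Finite (A i)]

open Classical in
theorem IsAggregatedOPI.measurable_comp (h_run : M.IsAggregatedOPI cl p θ₀ Pr ℱ γ μ X θ)
    {f : (∀ i, A i) → (ℕ → S) → ℝ} (hf : ∀ π, Measurable (f π)) (t : ℕ) :
    Measurable[ℱ (t + 1)] fun ω => f (μ t ω) (X t ω) := by
  have := Fintype.ofFinite (∀ i, A i)
  have e : (fun ω => f (μ t ω) (X t ω)) =
      fun ω => ∑ π, {ω | μ t ω = π}.indicator (fun ω => f π (X t ω)) ω := by
    ext ω
    rw [Finset.sum_eq_single (μ t ω)]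
    · simp
    · intro π _ hπ
      exact Set.indicator_of_notMem (s := {ω | μ t ω = π}) (fun h => hπ (Eq.symm h)) _
    · simp
  rw [e]
  exact Finset.measurable_sum (m := ℱ (t + 1)) _ fun π _ =>
    ((hf π).comp (h_run.traj_measurable t)).indicator
      (ℱ.mono (Nat.le_succ t) _ (h_run.policy_measurable t π))

variable [IsProbabilityMeasure Pr]

open Classical in
theorem IsAggregatedOPI.condExp_comp_eq_zero (h_run : M.IsAggregatedOPI cl p θ₀ Pr ℱ γ μ X θ)
    {f : (∀ i, A i) → (ℕ → S) → ℝ} (hf : ∀ π, Measurable (f π)) {C : ℝ}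
    (hC : ∀ π x, |f π x| ≤ C) (hf0 : ∀ π, ∫ x, f π x ∂(M.chainLaw p π) = 0) (t : ℕ) :
    Pr[fun ω => f (μ t ω) (X t ω) | ℱ t] =ᵐ[Pr] 0 := by
  have := Fintype.ofFinite (∀ i, A i)
  have hX : Measurable (X t) := (h_run.traj_measurable t).mono (ℱ.le _) le_rfl
  have hint : Integrable (fun ω => f (μ t ω) (X t ω)) Pr := Integrable.of_bound
    ((h_run.measurable_comp hf t).mono (ℱ.le _) le_rfl).aestronglyMeasurable C
    (ae_of_all _ fun ω => hC _ _)
  refine (ae_eq_condExp_of_forall_setIntegral_eq (ℱ.le t) hint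
    (fun s _ _ => integrableOn_zero) (fun s hs _ => ?_)
    stronglyMeasurable_zero.aestronglyMeasurable).symm
  have hπm : ∀ π, MeasurableSet {ω | μ t ω = π} := fun π =>
    ℱ.le t _ (h_run.policy_measurable t π)
  -- On each of the finitely many pieces the policy is constant and `map_restrict` gives the law of
  -- the trajectory.
  have hcover : s = ⋃ π, s ∩ {ω | μ t ω = π} := by
    ext ω
    simp
  have hzero : ∀ π, ∫ ω in s ∩ {ω | μ t ω = π}, f (μ t ω) (X t ω) ∂Pr = 0 := fun π => by
    have hD : MeasurableSet[ℱ t] (s ∩ {ω | μ t ω = π}) := hs.inter (h_run.policy_measurable t π)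
    rw [setIntegral_congr_fun (g := fun ω => f π (X t ω)) (ℱ.le t _ hD)
      (fun ω hω => by simp only [show μ t ω = π from hω.2]),
      ← integral_map (φ := X t) hX.aemeasurable (hf π).aestronglyMeasurable,
      h_run.map_restrict t hD (π := π) (fun ω hω => hω.2), integral_smul_measure, hf0, smul_zero]
  rw [hcover, integral_iUnion_fintype (fun π => (ℱ.le t _ hs).inter (hπm π))
    (fun π π' hne => Set.disjoint_left.2 fun ω h1 h2 => hne (h1.2.symm.trans h2.2))
    (fun π => hint.integrableOn), Finset.sum_eq_zero fun π _ => hzero π]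
  simp

/-- Weighted sums of centred functionals of the trajectories converge almost surely if their
quadratic variation is bounded. -/
theorem IsAggregatedOPI.ae_exists_tendsto_sum (h_run : M.IsAggregatedOPI cl p θ₀ Pr ℱ γ μ X θ)
    {f : (∀ i, A i) → (ℕ → S) → ℝ} (hf : ∀ π, Measurable (f π)) {C : ℝ}
    (hC : ∀ π x, |f π x| ≤ C) (hf0 : ∀ π, ∫ x, f π x ∂(M.chainLaw p π) = 0)
    {η : ℕ → Ω → ℝ} (hη : ∀ t, Measurable[ℱ t] (η t)) {B : ℝ} (hB : ∀ t ω, |η t ω| ≤ B) {K : ℝ}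
    (hK : ∀ n ω, ∑ t ∈ Finset.range n, (η t ω * f (μ t ω) (X t ω)) ^ 2 ≤ K) :
    ∀ᵐ ω ∂Pr, ∃ l, Tendsto (fun n => ∑ t ∈ Finset.range n, η t ω * f (μ t ω) (X t ω)) atTop
      (𝓝 l) := by
  have hfm := h_run.measurable_comp hf
  refine ae_exists_tendsto_sum_of_condExp_eq_zero (ℱ := ℱ)
    (ξ := fun t ω => η t ω * f (μ t ω) (X t ω))
    (fun t => ((hη t).mono (ℱ.mono (Nat.le_succ t)) le_rfl).mul (hfm t)) (fun t => ?_) hK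
  have hint : Integrable (fun ω => f (μ t ω) (X t ω)) Pr := Integrable.of_bound
    ((hfm t).mono (ℱ.le _) le_rfl).aestronglyMeasurable C (ae_of_all _ fun ω => hC _ _)
  have h := condExp_mul_of_stronglyMeasurable_left (hη t).stronglyMeasurable
    (hint.bdd_mul ((hη t).mono (ℱ.le t) le_rfl).aestronglyMeasurable (ae_of_all _ (hB t))) hint
  filter_upwards [h, h_run.condExp_comp_eq_zero hf hC hf0 t] with ω h1 h2
  refine h1.trans ?_
  simp [h2]

/-- Almost surely, the noise in the updates of every cluster sums to a convergent series. -/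
theorem IsAggregatedOPI.ae_exists_tendsto_sum_visitNoise
    (h_run : M.IsAggregatedOPI cl p θ₀ Pr ℱ γ μ X θ) (c : Fin k)
    (hβ_sq : Summable fun t => β t ^ 2)
    (h_step : (∀ t ω c, γ t ω c = β t) ∨
      (∀ t ω c, γ t ω c = β (visitCount cl (fun τ => X τ ω) t c))) :
    ∀ᵐ ω ∂Pr, ∃ l, Tendsto
      (fun n => ∑ t ∈ Finset.range n, γ t ω c * M.visitNoise cl c (μ t ω) (X t ω)) atTop
      (𝓝 l) := by
  classical
  choose C hC using fun π => (M.visitNoise_spec cl c π).2.1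
  obtain ⟨D, hD⟩ := (Set.finite_range C).bddAbove
  have hCD : ∀ π x, |M.visitNoise cl c π x| ≤ D := fun π x => (hC π x).trans (hD ⟨π, rfl⟩)
  have hβ : ∀ t, |β t| ≤ ∑' t, β t ^ 2 + 1 := fun t => by
    have := hβ_sq.le_tsum t fun _ _ => sq_nonneg _
    rw [abs_le]
    constructor <;> nlinarith [sq_nonneg (β t - 1), sq_nonneg (β t + 1)]
  refine h_run.ae_exists_tendsto_sum (fun π => (M.visitNoise_spec cl c π).1) hCD
    (M.integral_visitNoise cl c p) (fun t => h_run.measurable_stepSize h_step t c)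
    (B := ∑' t, β t ^ 2 + 1) (fun t ω => ?_) (K := (∑' t, β t ^ 2) * D ^ 2) fun n ω => ?_
  · rcases h_step with h | h <;> rw [h] <;> exact hβ _
  · refine le_trans ?_ (mul_le_mul_of_nonneg_right
      (sum_sq_stepSize_le (X := X) hβ_sq h_step c n ω) (sq_nonneg D))
    rw [Finset.sum_mul]
    refine Finset.sum_le_sum fun t _ => ?_
    split_ifs with hv
    · rw [mul_pow]
      exact mul_le_mul_of_nonneg_left (sq_le_sq.2 ((hCD _ _).trans (le_abs_self D)))
        (sq_nonneg _)
    · simp [visitNoise, hv]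

variable [∀ i, Nonempty (A i)]

open Classical in
theorem IsAggregatedOPI.ae_tendsto_sum_visits (h_run : M.IsAggregatedOPI cl p θ₀ Pr ℱ γ μ X θ)
    {c : Fin k} (h_reach : ∀ π : ∀ i, A i, 0 < M.chainLaw p π {x | Visits cl x c})
    {w : ℕ → ℝ} (hw0 : ∀ t, 0 ≤ w t)
    (hw : Tendsto (fun n => ∑ t ∈ Finset.range n, w t) atTop atTop)
    (hw2 : Summable fun t => w t ^ 2) :
    ∀ᵐ ω ∂Pr, Tendsto (fun n => ∑ t ∈ Finset.range n, if Visits cl (X t ω) c then w t else 0)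
      atTop atTop := by
  set q : (∀ i, A i) → ℝ := fun π => (M.chainLaw p π).real {x | Visits cl x c} with hq
  -- The least visit probability over the finitely many policies is positive. The visit indicators
  -- minus their conditional probabilities give a convergent weighted series, so the weights at
  -- visits sum to infinity like `q π₀` times all weights.
  obtain ⟨π₀, hπ₀⟩ := Finite.exists_min q
  have hδ : 0 < q π₀ := ENNReal.toReal_pos (h_reach π₀).ne' (measure_ne_top _ _)
  set f : (∀ i, A i) → (ℕ → S) → ℝ := fun π x =>
    {x | Visits cl x c}.indicator (fun _ => (1 : ℝ)) x - q π with hf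
  have hm := measurableSet_visits cl c
  have hfC : ∀ π x, |f π x| ≤ 1 := fun π x => by
    have h0 : 0 ≤ q π := measureReal_nonneg
    have h1 : q π ≤ 1 := measureReal_le_one
    simp only [hf, Set.indicator_apply]
    split_ifs <;> rw [abs_le] <;> constructor <;> linarith
  have hwle : ∀ t, |w t| ≤ ∑' t, w t ^ 2 + 1 := fun t => by
    have := hw2.le_tsum t fun _ _ => sq_nonneg _
    rw [abs_of_nonneg (hw0 t)]
    nlinarith [sq_nonneg (w t - 1)]
  have hconv := h_run.ae_exists_tendsto_sum (f := f)
    (fun π => (measurable_const.indicator hm).sub_const _) hfC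
    (fun π => by
      simp only [hf]
      rw [integral_sub ((integrable_const _).indicator hm) (integrable_const _),
        integral_indicator_const _ hm]
      simp [hq])
    (η := fun t _ => w t) (fun t => measurable_const) (fun t _ => hwle t)
    (K := ∑' t, w t ^ 2) (fun n ω => by
      refine (Finset.sum_le_sum fun t _ => ?_).trans
        (hw2.sum_le_tsum (Finset.range n) fun _ _ => sq_nonneg _)
      rw [mul_pow]
      exact mul_le_of_le_one_right (sq_nonneg _) ((sq_le_one_iff_abs_le_one _).2 (hfC _ _)))
  filter_upwards [hconv] with ω ⟨l, hl⟩
  have h1 : Tendsto (fun n => ∑ t ∈ Finset.range n, w t * f (μ t ω) (X t ω)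
      + q π₀ * ∑ t ∈ Finset.range n, w t) atTop atTop :=
    hl.add_atTop (hw.const_mul_atTop hδ)
  refine tendsto_atTop_mono (fun n => ?_) h1
  rw [Finset.mul_sum, ← Finset.sum_add_distrib]
  refine Finset.sum_le_sum fun t _ => ?_
  have h2 := mul_le_mul_of_nonneg_right (hπ₀ (μ t ω)) (hw0 t)
  simp only [hf, Set.indicator_apply, Set.mem_ofPred_eq]
  split_ifs <;> linarith

/-- Almost surely, every cluster is updated with step sizes of infinite total weight. -/
theorem IsAggregatedOPI.ae_tendsto_sum_stepSize
    (h_run : M.IsAggregatedOPI cl p θ₀ Pr ℱ γ μ X θ) {c : Fin k}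
    (h_reach : ∀ π : ∀ i, A i, 0 < M.chainLaw p π {x | Visits cl x c})
    (hβ_nonneg : ∀ t, 0 ≤ β t)
    (hβ_sum : Tendsto (fun n => ∑ t ∈ Finset.range n, β t) atTop atTop)
    (hβ_sq : Summable fun t => β t ^ 2)
    (h_step : (∀ t ω c, γ t ω c = β t) ∨
      (∀ t ω c, γ t ω c = β (visitCount cl (fun τ => X τ ω) t c))) :
    open Classical in
    ∀ᵐ ω ∂Pr, Tendsto
      (fun n => ∑ t ∈ Finset.range n, if Visits cl (X t ω) c then γ t ω c else 0) atTop atTop := by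
  classical
  rcases h_step with h | h
  · simp only [h]
    exact h_run.ae_tendsto_sum_visits h_reach hβ_nonneg hβ_sum hβ_sq
  -- Harmonic weights are at most `1`, so their divergence along the visits shows that there are
  -- infinitely many visits; the step sizes used then exhaust the series of `β`.
  · have hharm := Real.tendsto_sum_range_one_div_nat_succ_atTop
    have hsq : Summable fun t : ℕ => (1 / ((t : ℝ) + 1)) ^ 2 := by
      have := (summable_nat_add_iff 1).2 (Real.summable_one_div_nat_pow.2 one_lt_two)
      simpa using this
    filter_upwards [h_run.ae_tendsto_sum_visits h_reach (w := fun t => 1 / ((t : ℝ) + 1))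
      (fun t => by positivity) hharm hsq] with ω hω
    have hcount : Tendsto (fun n => visitCount cl (fun τ => X τ ω) n c) atTop atTop := by
      rw [← tendsto_natCast_atTop_iff (R := ℝ)]
      refine tendsto_atTop_mono (fun n => ?_) hω
      rw [visitCount_eq_sum]
      push_cast
      refine Finset.sum_le_sum fun t _ => ?_
      split_ifs
      · rw [div_le_one (by positivity)]
        linarith [(Nat.cast_nonneg t : (0 : ℝ) ≤ t)]
      · exact le_rfl
    simp only [h, sum_visits_comp_visitCount (fun τ => X τ ω) c β]
    exact hβ_sum.comp hcount

end Runs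

end DiscountedMDP

/-! ### Convergence by induction on the level -/

theorem mainTheorem4
    {S : Type*} [Fintype S] [MeasurableSpace S] [MeasurableSingletonClass S]
    {A : S → Type*} [∀ i, Finite (A i)] [∀ i, Nonempty (A i)]
    (M : DiscountedMDP S A)
    (h_common : M.CommonTransitions)
    (h_acyclic : M.TransientAcyclic)
    (h_absorbing : ∀ i, ¬ M.IsTransient i → M.IsAbsorbing i)
    {k : ℕ} (cl : S → Fin k)
    (h_value : ∀ i j, cl i = cl j → M.optValue i = M.optValue j)
    (h_dist : ∀ i j, cl i = cl j → M.maxDist i = M.maxDist j)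
    (p : PMF S)
    (h_reach : ∀ (π : ∀ i, A i) (c : Fin k),
      0 < M.chainLaw p π {x | DiscountedMDP.Visits cl x c})
    (β : ℕ → ℝ) (hβ_nonneg : ∀ t, 0 ≤ β t)
    (hβ_sum : Tendsto (fun n => ∑ t ∈ Finset.range n, β t) atTop atTop)
    (hβ_sq : Summable fun t => β t ^ 2)
    {Ω : Type*} {mΩ : MeasurableSpace Ω} (Pr : Measure Ω) [IsProbabilityMeasure Pr]
    (ℱ : Filtration ℕ mΩ)
    (θ₀ : Fin k → ℝ) (γ : ℕ → Ω → Fin k → ℝ)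
    (μ : ℕ → Ω → ∀ i, A i) (X : ℕ → Ω → ℕ → S) (θ : ℕ → Ω → Fin k → ℝ)
    (h_run : M.IsAggregatedOPI cl p θ₀ Pr ℱ γ μ X θ)
    (h_step : (∀ t ω c, γ t ω c = β t) ∨
      (∀ t ω c, γ t ω c = β (DiscountedMDP.visitCount cl (fun τ => X τ ω) t c))) :
    ∀ᵐ ω ∂Pr, ∀ i, Tendsto (fun t => θ t ω (cl i)) atTop (𝓝 (M.optValue i)) := by
  classical
  have hweights := ae_all_iff.2 fun c => h_run.ae_tendsto_sum_stepSize (fun π => h_reach π c)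
    hβ_nonneg hβ_sum hβ_sq h_step
  have hnoise := ae_all_iff.2 fun c => h_run.ae_exists_tendsto_sum_visitNoise c hβ_sq h_step
  filter_upwards [hweights, hnoise] with ω hω hω' i
  induction hd : M.maxDist i using Nat.strong_induction_on generalizing i with
  | _ d ih =>
    have hopt := DiscountedMDP.eventually_bellmanFixedPoint_eq_optValue h_acyclic h_absorbing
      (J := fun t j => θ t ω (cl j)) (μ := fun t => μ t ω) (fun t π => h_run.greedy t ω π)
      (fun j hj => ih _ hj j rfl)
    obtain ⟨l, hl⟩ := hω' (cl i)
    have hγ0 : ∀ t, 0 ≤ γ t ω (cl i) := fun t => by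
      rcases h_step with h | h <;> rw [h] <;> exact hβ_nonneg _
    -- With weight zero at iterations that miss the cluster, updates and non-updates obey one
    -- recursion.
    set a : ℕ → ℝ := fun t =>
      if DiscountedMDP.Visits cl (X t ω) (cl i) then γ t ω (cl i) else 0 with ha
    have ha2 : Summable fun t => a t ^ 2 := by
      refine summable_of_sum_range_le (c := ∑' t, β t ^ 2) (fun t => sq_nonneg _) fun n => ?_
      simp only [ha, ite_pow, ne_eq, OfNat.ofNat_ne_zero, not_false_eq_true, zero_pow]
      exact DiscountedMDP.sum_sq_stepSize_le hβ_sq h_step (cl i) n ω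
    have halim : Tendsto a atTop (𝓝 0) := by
      have h := ha2.tendsto_atTop_zero.sqrt
      simp only [Real.sqrt_sq_eq_abs, Real.sqrt_zero] at h
      exact (tendsto_zero_iff_abs_tendsto_zero a).2 h
    have hx := tendsto_zero_of_averaging (x := fun t => θ t ω (cl i) - M.optValue i) (a := a)
      (fun t => by
        simp only [ha]
        split_ifs
        exacts [hγ0 t, le_rfl]) halim (hω (cl i)) hl (by
        filter_upwards [hopt] with t ht
        rw [Finset.sum_range_succ, add_sub_cancel_left]
        by_cases hv : DiscountedMDP.Visits cl (X t ω) (cl i)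
        · have hcl := hv.cl_firstVisit
          -- The state first visited need not be `i`; equal levels make the policy optimal there,
          -- and equal values make the target `J^*` at `i`.
          have hW : M.bellmanFixedPoint (μ t ω)
              (X t ω (DiscountedMDP.firstVisit cl (X t ω) (cl i)))
              = M.optValue i := by
            rw [ht _ ((h_dist _ _ hcl).trans hd).le, h_value _ _ hcl]
          simp only [ha, if_pos hv, DiscountedMDP.visitNoise, hW, h_run.update_visited t ω _ hv]
          ring
        · simp only [ha, if_neg hv, DiscountedMDP.visitNoise, h_run.update_not_visited t ω _ hv]
          ring)
    simpa using hx.add_const (M.optValue i)
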